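/- Let $n,m\ge 0$ be integers, let $a>0$, and let $\nu_1<\dots<\nu_{n+m}$ be real numbers with $\nu_j<0$ for $1\le j\le n$ and $\nu_j>0$ for $n<j\le n+m$. Let $\gamma_1$ be a positively oriented, piecewise $C^1$, simple closed contour in the open left half plane $\{\operatorname{Re} z<0\}$ containing $\nu_1,\dots,\nu_n$ in its interior, and let $\gamma_2$ be a positively oriented, piecewise $C^1$, simple closed contour in the open right half plane $\{\operatorname{Re} z>0\}$ containing $\nu_{n+1},\dots,\nu_{n+m}$ in its interior. Define $$M_0(x,y)=\frac{a}{(2\pi i)^2}\int_{\gamma_1}d\zeta\int_{\gamma_2}d\omega\, e^{ax\zeta-ay\omega}\frac{1}{\zeta-\omega}\prod_{j=1}^n\frac{1-\omega/\nu_j}{1-\zeta/\nu_j}\prod_{j=1}^m\frac{1-\zeta/\nu_{n+j}}{1-\omega/\nu_{n+j}},$$ $$\hat M_0(x,y)=\frac{a}{(2\pi i)^2}\int_{\gamma_2}d\zeta\int_{\gamma_1}d\omega\, e^{-ax\zeta+ay\omega}\frac{1}{\omega-\zeta}\prod_{j=1}^m\frac{1-\omega/\nu_{n+j}}{1-\zeta/\nu_{n+j}}\prod_{j=1}^n\frac{1-\zeta/\nu_j}{1-\omega/\nu_j}.$$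 Then the integral operators on $L^2[1,\infty)$ with kernels $M_0$ and $\hat M_0$ are well-defined bounded operators of finite rank, and their determinants satisfy $$\det(I-M_0)_{L^2[1,\infty)}>0\qquad\text{and}\qquad \det(I-\hat M_0)_{L^2[1,\infty)}>0 .$$ (For an operator $T$ of finite rank, $\det(I-T)$ is the determinant of the restriction of $I-T$ to the range of $T$; that the determinants are real is part of the claim.) -/

import Mathlib

open MeasureTheory Set

noncomputable section

/-- A simple closed contour in the complex plane: a closed curve `path`, parametrized by `[0, 1]`,
which is injective on `[0, 1)` and is `C¹` on each piece (endpoints included) of some finite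
partition of `[0, 1]`. -/
structure SimpleClosedContour where
  base : ℂ
  path : Path base base
  injOn : Set.InjOn path.extend (Set.Ico 0 1)
  piecewise_contDiff : ∃ (k : ℕ) (τ : Fin (k + 1) → ℝ), StrictMono τ ∧ τ 0 = 0 ∧
    τ (Fin.last k) = 1 ∧
    ∀ i : Fin k, ContDiffOn ℝ 1 path.extend (Set.Icc (τ i.castSucc) (τ i.succ))

namespace SimpleClosedContour

/-- The trace (set of points) of the contour. -/
def trace (γ : SimpleClosedContour) : Set ℂ := Set.range γ.path

/-- The interior of the contour: the points off the contour that lie in a bounded connected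
component of its complement. -/
def interior (γ : SimpleClosedContour) : Set ℂ :=
  {p | p ∉ γ.trace ∧ Bornology.IsBounded (connectedComponentIn γ.traceᶜ p)}

/-- The contour integral `∫_γ f(z) dz`. -/
def integral (γ : SimpleClosedContour) (f : ℂ → ℂ) : ℂ :=
  curveIntegral (fun z : ℂ => ContinuousLinearMap.toSpanSingleton ℂ (f z)) γ.path

/-- The contour is traversed counterclockwise: its winding number about every interior point
is `1`. -/
def PositivelyOriented (γ : SimpleClosedContour) : Prop :=
  ∀ p ∈ γ.interior, (2 * Real.pi * Complex.I)⁻¹ * γ.integral (fun z => (z - p)⁻¹) = 1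

end SimpleClosedContour

/-- The kernel `M₀(x, y)`. The points `ν₁, …, νₙ` are `ν (Fin.castAdd m j)`, `j : Fin n`, and
`νₙ₊₁, …, νₙ₊ₘ` are `ν (Fin.natAdd n j)`, `j : Fin m`. -/
def kernelM {n m : ℕ} (a : ℝ) (ν : Fin (n + m) → ℝ) (γ₁ γ₂ : SimpleClosedContour)
    (x y : ℝ) : ℂ :=
  (a : ℂ) / (2 * Real.pi * Complex.I) ^ 2 *
    γ₁.integral fun ζ => γ₂.integral fun ω =>
      Complex.exp (a * x * ζ - a * y * ω) * (1 / (ζ - ω)) *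
        (∏ j : Fin n, (1 - ω / (ν (Fin.castAdd m j) : ℂ)) / (1 - ζ / (ν (Fin.castAdd m j) : ℂ))) *
        (∏ j : Fin m, (1 - ζ / (ν (Fin.natAdd n j) : ℂ)) / (1 - ω / (ν (Fin.natAdd n j) : ℂ)))

/-- The kernel `M̂₀(x, y)`, with the same indexing of the points. -/
def kernelMHat {n m : ℕ} (a : ℝ) (ν : Fin (n + m) → ℝ) (γ₁ γ₂ : SimpleClosedContour)
    (x y : ℝ) : ℂ :=
  (a : ℂ) / (2 * Real.pi * Complex.I) ^ 2 *
    γ₂.integral fun ζ => γ₁.integral fun ω =>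
      Complex.exp (-(a * x * ζ) + a * y * ω) * (1 / (ω - ζ)) *
        (∏ j : Fin m, (1 - ω / (ν (Fin.natAdd n j) : ℂ)) / (1 - ζ / (ν (Fin.natAdd n j) : ℂ))) *
        (∏ j : Fin n, (1 - ζ / (ν (Fin.castAdd m j) : ℂ)) / (1 - ω / (ν (Fin.castAdd m j) : ℂ)))

/-- The complex Hilbert space `L²[1, ∞)`. -/
abbrev L2Ici : Type := Lp ℂ 2 (volume.restrict (Set.Ici (1 : ℝ)))

/-- `T` is the integral operator on `L²[1, ∞)` with kernel `k`:
`(T f)(x) = ∫_{[1, ∞)} k(x, y) f(y) dy` for almost every `x ≥ 1`, with an absolutely convergent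
integral. -/
def IsIntegralOperator (k : ℝ → ℝ → ℂ) (T : L2Ici →L[ℂ] L2Ici) : Prop :=
  ∀ f : L2Ici,
    (∀ᵐ x ∂(volume.restrict (Set.Ici (1 : ℝ))), IntegrableOn (fun y => k x y * f y) (Set.Ici 1)) ∧
    ∀ᵐ x ∂(volume.restrict (Set.Ici (1 : ℝ))), T f x = ∫ y in Set.Ici (1 : ℝ), k x y * f y

/-- An operator of finite rank. -/
def HasFiniteRank {H : Type*} [NormedAddCommGroup H] [NormedSpace ℂ H] (T : H →L[ℂ] H) : Prop :=
  FiniteDimensional ℂ T.range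

/-- The determinant `det (I - T)` of a finite rank operator `T`: the determinant of the
restriction of `I - T` to the finite-dimensional invariant subspace `range T` (on the quotient by
`range T`, `I - T` acts as the identity). -/
def detOneSub {H : Type*} [NormedAddCommGroup H] [NormedSpace ℂ H] (T : H →L[ℂ] H) : ℂ :=
  LinearMap.det <|
    ((LinearMap.id : H →ₗ[ℂ] H) - (T : H →ₗ[ℂ] H)).restrict (p := T.range) (q := T.range)
      fun x hx => T.range.sub_mem hx ⟨x, rfl⟩

end

/-!
By the residue theorem in each variable, `M₀(x, y)` is a finite sum
`a ∑ i k, C i k * e^{a x v i - a y w k}`, where the `v i` are the negative points, the `w k` the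
positive ones and `C` is a real matrix; `M̂₀(x, y)` is the same integral in the other order with
`x` and `y` exchanged. Each operator is thus a finite sum of rank one operators built from decaying
exponentials, and by Sylvester's identity both determinants equal `D(a) = det (1 - C G(a))`, where
`G(a) k i = e^{-a (w k - v i)} / (w k - v i)`.

The real function `D` is continuous and tends to `1` as `a → ∞`, so it is positive on `(0, ∞)` once
it has no zero there (`det_one_sub_residueMatrix_mul_ne_zero`). Suppose `x = C G(a) x`. With
`L(z) = ∏ i, (1 - z / v i)` and `R(z) = ∏ k, (1 - z / w k)`, partial fractions with numerators read
off from `x` and `G(a) x` give polynomials `Q = L ∑ i, e^{a v i} x i / (z - v i)` and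
`P = R ∑ k, d k / (z - w k)`, and the fixed point equation says exactly that
`Q(z) = e^{a z} P(z)` at all the points `v i` and `w k`. Since `deg Q < n` and `deg P < m`, Rolle's
theorem allows `Q(z) - e^{a z} P(z)` at most `n + m - 1` real zeros unless `P = Q = 0`
(`eq_zero_of_eval_eq_exp_mul_eval`), and then `x = 0`.
-/

noncomputable section

/-! ### Contour integrals and residues -/

namespace SimpleClosedContour

lemma extend_mem_trace (γ : SimpleClosedContour) (t : ℝ) : γ.path.extend t ∈ γ.trace := by
  rw [trace, ← Path.extend_range]
  exact mem_range_self t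

lemma integral_eq_intervalIntegral (γ : SimpleClosedContour) (f : ℂ → ℂ) :
    γ.integral f = ∫ t in (0 : ℝ)..1, deriv γ.path.extend t * f (γ.path.extend t) := by
  simp [integral, curveIntegral_eq_intervalIntegral_deriv]

lemma integral_congr (γ : SimpleClosedContour) {f g : ℂ → ℂ} (h : EqOn f g γ.trace) :
    γ.integral f = γ.integral g := by
  simp only [integral_eq_intervalIntegral]
  congr 1 with t
  rw [h (γ.extend_mem_trace t)]

lemma integral_const_mul (γ : SimpleClosedContour) (c : ℂ) (f : ℂ → ℂ) :
    γ.integral (fun z => c * f z) = c * γ.integral f := by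
  simp only [integral_eq_intervalIntegral, ← intervalIntegral.integral_const_mul]
  congr 1 with t
  ring

/-- The partition of `[0, 1]` into smooth pieces, indexed by natural numbers. -/
lemma exists_partition (γ : SimpleClosedContour) :
    ∃ (k : ℕ) (τ : ℕ → ℝ), τ 0 = 0 ∧ τ k = 1 ∧
      ∀ i < k, τ i < τ (i + 1) ∧ ContDiffOn ℝ 1 γ.path.extend (Icc (τ i) (τ (i + 1))) := by
  obtain ⟨k, τ, hτ, h0, h1, hd⟩ := γ.piecewise_contDiff
  refine ⟨k, fun i => if h : i < k + 1 then τ ⟨i, h⟩ else 0, by simpa using h0,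
    by simpa [Fin.last] using h1, fun i hi => ?_⟩
  have h1 : i < k + 1 := by omega
  have h2 : i + 1 < k + 1 := by omega
  simp only [h1, h2, dif_pos]
  exact ⟨hτ (by simp [Fin.lt_def]), hd ⟨i, hi⟩⟩

lemma intervalIntegrable_piece (γ : SimpleClosedContour) {f : ℂ → ℂ}
    (hf : ContinuousOn f γ.trace) {u v : ℝ} (huv : u < v)
    (hd : ContDiffOn ℝ 1 γ.path.extend (Icc u v)) :
    IntervalIntegrable (fun t => deriv γ.path.extend t * f (γ.path.extend t)) volume u v := by
  have hc : ContinuousOn (fun t => derivWithin γ.path.extend (Icc u v) t * f (γ.path.extend t))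
      (Icc u v) :=
    (hd.continuousOn_derivWithin (uniqueDiffOn_Icc huv) le_rfl).mul
      (hf.comp γ.path.continuous_extend.continuousOn fun t _ => γ.extend_mem_trace t)
  rw [← uIcc_of_le huv.le] at hc
  refine hc.intervalIntegrable.congr_ae ?_
  rw [uIoc_of_le huv.le, ← restrict_Ioo_eq_restrict_Ioc]
  filter_upwards [ae_restrict_mem measurableSet_Ioo] with t ht
  rw [uIcc_of_le huv.le, derivWithin_of_mem_nhds (Icc_mem_nhds ht.1 ht.2)]

lemma intervalIntegrable (γ : SimpleClosedContour) {f : ℂ → ℂ} (hf : ContinuousOn f γ.trace) :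
    IntervalIntegrable (fun t => deriv γ.path.extend t * f (γ.path.extend t)) volume 0 1 := by
  obtain ⟨k, τ, h0, h1, h⟩ := γ.exists_partition
  rw [← h0, ← h1]
  exact IntervalIntegrable.trans_iterate fun i hi =>
    γ.intervalIntegrable_piece hf (h i hi).1 (h i hi).2

lemma integral_add (γ : SimpleClosedContour) {f g : ℂ → ℂ} (hf : ContinuousOn f γ.trace)
    (hg : ContinuousOn g γ.trace) :
    γ.integral (fun z => f z + g z) = γ.integral f + γ.integral g := by
  simp only [integral_eq_intervalIntegral, mul_add]
  exact intervalIntegral.integral_add (γ.intervalIntegrable hf) (γ.intervalIntegrable hg)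

lemma integral_sum (γ : SimpleClosedContour) {ι : Type*} (s : Finset ι) {f : ι → ℂ → ℂ}
    (hf : ∀ i ∈ s, ContinuousOn (f i) γ.trace) :
    γ.integral (fun z => ∑ i ∈ s, f i z) = ∑ i ∈ s, γ.integral (f i) := by
  simp only [integral_eq_intervalIntegral, Finset.mul_sum]
  exact intervalIntegral.integral_finsetSum fun i hi => γ.intervalIntegrable (hf i hi)

/-- Cauchy's theorem on a convex open set: a holomorphic function has a primitive there, and the
fundamental theorem of calculus telescopes over the smooth pieces of the closed contour. -/
lemma integral_eq_zero_of_differentiableOn (γ : SimpleClosedContour) {U : Set ℂ}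
    (hU : Convex ℝ U) (hUo : IsOpen U) (hγ : γ.trace ⊆ U) {f : ℂ → ℂ}
    (hf : DifferentiableOn ℂ f U) : γ.integral f = 0 := by
  obtain ⟨F, hF⟩ := hU.exists_forall_hasDerivWithinAt hf
  have hfc := hf.continuousOn.mono hγ
  obtain ⟨k, τ, h0, h1, h⟩ := γ.exists_partition
  have hint := fun i (hi : i < k) => γ.intervalIntegrable_piece hfc (h i hi).1 (h i hi).2
  rw [integral_eq_intervalIntegral, ← h0, ← h1,
    ← intervalIntegral.sum_integral_adjacent_intervals hint]
  have hpiece : ∀ i ∈ Finset.range k,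
      ∫ t in τ i..τ (i + 1), deriv γ.path.extend t * f (γ.path.extend t) =
        F (γ.path.extend (τ (i + 1))) - F (γ.path.extend (τ i)) := by
    intro i hi
    rw [Finset.mem_range] at hi
    obtain ⟨hlt, hd⟩ := h i hi
    have hFc : Continuous fun t => F (γ.path.extend t) :=
      continuous_iff_continuousAt.2 fun t =>
        ((hF _ (hγ (γ.extend_mem_trace t))).hasDerivAt
          (hUo.mem_nhds (hγ (γ.extend_mem_trace t)))).continuousAt.comp
          γ.path.continuous_extend.continuousAt
    refine intervalIntegral.integral_eq_sub_of_hasDerivAt_of_le hlt.le hFc.continuousOn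
      (fun t ht => ?_) (hint i hi)
    have hm := hγ (γ.extend_mem_trace t)
    have hγ' : HasDerivAt γ.path.extend (deriv γ.path.extend t) t :=
      ((hd.differentiableOn one_ne_zero t (Ioo_subset_Icc_self ht)).differentiableAt
        (Icc_mem_nhds ht.1 ht.2)).hasDerivAt
    have := ((hF _ hm).hasDerivAt (hUo.mem_nhds hm)).comp_of_eq t hγ' rfl
    rw [mul_comm]
    exact this
  rw [Finset.sum_congr rfl hpiece, Finset.sum_range_sub (fun i => F (γ.path.extend (τ i))), h0, h1]
  simp

/-- Cauchy's integral formula: subtracting the pole with `dslope` leaves a holomorphic function,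
and the remaining `(z - c)⁻¹` integrates to `2πi` by orientation. -/
lemma integral_div_sub (γ : SimpleClosedContour) (hpo : γ.PositivelyOriented) {U : Set ℂ}
    (hU : Convex ℝ U) (hUo : IsOpen U) (hγ : γ.trace ⊆ U) {f : ℂ → ℂ}
    (hf : DifferentiableOn ℂ f U) {c : ℂ} (hc : c ∈ γ.interior) (hcU : c ∈ U) :
    γ.integral (fun z => f z / (z - c)) = 2 * Real.pi * Complex.I * f c := by
  have hne : ∀ z ∈ γ.trace, z - c ≠ 0 := fun z hz h =>
    hc.1 (by rwa [sub_eq_zero.1 h] at hz)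
  have hds : DifferentiableOn ℂ (dslope f c) U :=
    (Complex.differentiableOn_dslope (hUo.mem_nhds hcU)).2 hf
  have hcongr : EqOn (fun z => f z / (z - c)) (fun z => dslope f c z + f c * (z - c)⁻¹)
      γ.trace := by
    intro z hz
    have h := hne z hz
    simp only [dslope_of_ne f (sub_ne_zero.1 h), slope_def_field]
    field_simp
    ring
  have hinv : ContinuousOn (fun z : ℂ => (z - c)⁻¹) γ.trace :=
    ContinuousOn.inv₀ (by fun_prop) hne
  rw [γ.integral_congr hcongr, integral_add γ (g := fun z => f c * (z - c)⁻¹)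
    (hds.continuousOn.mono hγ) (continuousOn_const.mul hinv), γ.integral_eq_zero_of_differentiableOn hU hUo hγ hds,
    integral_const_mul]
  have h := hpo c hc
  have hpi : (2 * Real.pi * Complex.I : ℂ) ≠ 0 := Complex.two_pi_I_ne_zero
  rw [inv_mul_eq_div, div_eq_one_iff_eq hpi] at h
  rw [h]
  ring

end SimpleClosedContour

/-- The residue at `v j` of `1 / ∏ i, (1 - z / v i)`. -/
def poleWeight {K ι : Type*} [Field K] [Fintype ι] [DecidableEq ι] (v : ι → K) (j : ι) : K :=
  -v j * ∏ i ∈ Finset.univ.erase j, (1 - v j / v i)⁻¹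

lemma ofReal_poleWeight {ι : Type*} [Fintype ι] [DecidableEq ι] (v : ι → ℝ) (j : ι) :
    ((poleWeight v j : ℝ) : ℂ) = poleWeight (fun i => (v i : ℂ)) j := by
  simp [poleWeight]

lemma inv_prod_eq_sum_poleWeight {K ι : Type*} [Field K] [Fintype ι] [DecidableEq ι] [Nonempty ι]
    {v : ι → K} (hv : Function.Injective v) (hv0 : ∀ i, v i ≠ 0) {z : K} (hz : ∀ i, z ≠ v i) :
    (∏ i, (1 - z / v i))⁻¹ = ∑ j, poleWeight v j / (z - v j) := by
  have h := congrArg (Polynomial.eval z)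
    (Lagrange.sum_basis (s := Finset.univ) hv.injOn Finset.univ_nonempty)
  have hzi : ∀ i, 1 - z / v i ≠ 0 := fun i h =>
    hz i (by rw [sub_eq_zero, eq_comm, div_eq_one_iff_eq (hv0 i)] at h; exact h)
  rw [Polynomial.eval_finsetSum, Polynomial.eval_one] at h
  have hmul : (∏ i, (1 - z / v i))⁻¹ = (∏ i, (1 - z / v i))⁻¹ *
      ∑ i, Polynomial.eval z (Lagrange.basis Finset.univ v i) := by rw [h, mul_one]
  rw [hmul, Finset.mul_sum]
  refine Finset.sum_congr rfl fun j _ => ?_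
  have hL : Polynomial.eval z (Lagrange.basis Finset.univ v j) =
      (∏ i ∈ Finset.univ.erase j, (1 - z / v i)) *
        ∏ i ∈ Finset.univ.erase j, (1 - v j / v i)⁻¹ := by
    rw [Lagrange.basis, Polynomial.eval_prod, ← Finset.prod_mul_distrib]
    refine Finset.prod_congr rfl fun i hi => ?_
    have hij : v j - v i ≠ 0 := sub_ne_zero.2 fun h => Finset.ne_of_mem_erase hi (hv h).symm
    have hji : v i - v j ≠ 0 := by rwa [← neg_sub, neg_ne_zero]
    have h0 := hv0 i
    have : 1 - v j / v i = (v i - v j) / v i := by field_simp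
    rw [this]
    simp only [Lagrange.basisDivisor, Polynomial.eval_mul, Polynomial.eval_C, Polynomial.eval_sub,
      Polynomial.eval_X]
    field_simp
    ring
  rw [hL, ← Finset.mul_prod_erase Finset.univ _ (Finset.mem_univ j), poleWeight]
  have hp : ∏ i ∈ Finset.univ.erase j, (1 - z / v i) ≠ 0 :=
    Finset.prod_ne_zero_iff.2 fun i _ => hzi i
  have hzj : z - v j ≠ 0 := sub_ne_zero.2 (hz j)
  have h0 := hv0 j
  have h1 : 1 - z / v j = -(z - v j) / v j := by field_simp; ring
  rw [h1]
  field_simp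

namespace SimpleClosedContour

/-- The residue theorem for simple poles at distinct nonzero points inside the contour. -/
lemma integral_div_prod (γ : SimpleClosedContour) (hpo : γ.PositivelyOriented) {U : Set ℂ}
    (hU : Convex ℝ U) (hUo : IsOpen U) (hγ : γ.trace ⊆ U) {f : ℂ → ℂ}
    (hf : DifferentiableOn ℂ f U) {ι : Type*} [Fintype ι] [DecidableEq ι] {v : ι → ℂ}
    (hv : Function.Injective v) (hv0 : ∀ i, v i ≠ 0) (hin : ∀ i, v i ∈ γ.interior)
    (hvU : ∀ i, v i ∈ U) :
    γ.integral (fun z => f z / ∏ i, (1 - z / v i)) =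
      2 * Real.pi * Complex.I * ∑ j, poleWeight v j * f (v j) := by
  rcases isEmpty_or_nonempty ι with h | h
  -- Without poles there is no partial fraction expansion of `1`, but both sides vanish.
  · simpa using γ.integral_eq_zero_of_differentiableOn hU hUo hγ hf
  have hne : ∀ i, ∀ z ∈ γ.trace, z - v i ≠ 0 := fun i z hz h =>
    (hin i).1 (by rwa [sub_eq_zero.1 h] at hz)
  have hcongr : EqOn (fun z => f z / ∏ i, (1 - z / v i))
      (fun z => ∑ j, poleWeight v j * (f z / (z - v j))) γ.trace := by
    intro z hz
    simp only
    rw [div_eq_mul_inv, inv_prod_eq_sum_poleWeight hv hv0 fun i => sub_ne_zero.1 (hne i z hz),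
      Finset.mul_sum]
    exact Finset.sum_congr rfl fun j _ => by ring
  rw [γ.integral_congr hcongr, integral_sum, Finset.mul_sum]
  · refine Finset.sum_congr rfl fun j _ => ?_
    rw [integral_const_mul, γ.integral_div_sub hpo hU hUo hγ hf (hin j) (hvU j)]
    ring
  · exact fun j _ => continuousOn_const.mul
      ((hf.continuousOn.mono hγ).div (by fun_prop) (hne j))

/-- The residue theorem applied in each of two variables. -/
lemma integral_integral_div_prod {γ₁ γ₂ : SimpleClosedContour} (hpo₁ : γ₁.PositivelyOriented)
    (hpo₂ : γ₂.PositivelyOriented) {U₁ U₂ : Set ℂ} (hU₁ : Convex ℝ U₁) (hUo₁ : IsOpen U₁)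
    (hU₂ : Convex ℝ U₂) (hUo₂ : IsOpen U₂) (hγ₁ : γ₁.trace ⊆ U₁) (hγ₂ : γ₂.trace ⊆ U₂)
    {ι κ : Type*} [Fintype ι] [DecidableEq ι] [Fintype κ] [DecidableEq κ]
    {v : ι → ℂ} (hv : Function.Injective v) (hv0 : ∀ i, v i ≠ 0) (hvin : ∀ i, v i ∈ γ₁.interior)
    (hvU : ∀ i, v i ∈ U₁)
    {w : κ → ℂ} (hw : Function.Injective w) (hw0 : ∀ i, w i ≠ 0) (hwin : ∀ i, w i ∈ γ₂.interior)
    (hwU : ∀ i, w i ∈ U₂)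
    {g : ℂ → ℂ → ℂ} (hg₁ : ∀ ω ∈ U₂, DifferentiableOn ℂ (fun ζ => g ζ ω) U₁)
    (hg₂ : ∀ ζ ∈ U₁, DifferentiableOn ℂ (g ζ) U₂) :
    γ₁.integral (fun ζ => γ₂.integral fun ω =>
        g ζ ω / (∏ i, (1 - ζ / v i)) / ∏ k, (1 - ω / w k)) =
      (2 * Real.pi * Complex.I) ^ 2 *
        ∑ i, ∑ k, poleWeight v i * poleWeight w k * g (v i) (w k) := by
  have hcongr : EqOn (fun ζ => γ₂.integral fun ω =>
        g ζ ω / (∏ i, (1 - ζ / v i)) / ∏ k, (1 - ω / w k))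
      (fun ζ => (2 * Real.pi * Complex.I * ∑ k, poleWeight w k * g ζ (w k)) /
        ∏ i, (1 - ζ / v i)) γ₁.trace := by
    intro ζ hζ
    simp only
    rw [γ₂.integral_div_prod hpo₂ hU₂ hUo₂ hγ₂ ((hg₂ ζ (hγ₁ hζ)).div_const _) hw hw0 hwin hwU,
      mul_div_assoc, Finset.sum_div]
    congr 1
    exact Finset.sum_congr rfl fun k _ => by ring
  rw [γ₁.integral_congr hcongr, γ₁.integral_div_prod hpo₁ hU₁ hUo₁ hγ₁ ?_ hv hv0 hvin hvU]
  · simp only [Finset.mul_sum]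
    exact Finset.sum_congr rfl fun i _ => Finset.sum_congr rfl fun k _ => by ring
  · refine (differentiableOn_const _).mul (DifferentiableOn.fun_sum fun k _ => ?_)
    exact (differentiableOn_const _).mul (hg₁ _ (hwU k))

end SimpleClosedContour

/-! ### Determinants of finite rank operators -/

/-- Sylvester's determinant identity for linear maps. -/
lemma det_id_sub_comp_comm {K V W : Type*} [Field K] [AddCommGroup V] [Module K V]
    [AddCommGroup W] [Module K W] [FiniteDimensional K V] [FiniteDimensional K W]
    (f : V →ₗ[K] W) (g : W →ₗ[K] V) :
    LinearMap.det (LinearMap.id - f ∘ₗ g) = LinearMap.det (LinearMap.id - g ∘ₗ f) := by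
  let b := Module.finBasis K V
  let c := Module.finBasis K W
  rw [← LinearMap.det_toMatrix c, ← LinearMap.det_toMatrix b, map_sub, map_sub,
    LinearMap.toMatrix_comp c b c, LinearMap.toMatrix_comp b c b, LinearMap.toMatrix_id,
    LinearMap.toMatrix_id, Matrix.det_one_sub_mul_comm]

/-- `I - S` acts as the identity modulo any subspace containing the range of `S`, so its
determinant can be computed on that subspace. -/
lemma det_id_sub_restrict {K V : Type*} [Field K] [AddCommGroup V] [Module K V]
    [FiniteDimensional K V] (S : V →ₗ[K] V) (W : Submodule K V) (hW : ∀ x, S x ∈ W) :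
    LinearMap.det (LinearMap.id - S) =
      LinearMap.det ((LinearMap.id - S).restrict (p := W) (q := W)
        fun x hx => W.sub_mem hx (hW x)) := by
  have he : W ≤ W.comap (LinearMap.id - S) := fun x hx => W.sub_mem hx (hW x)
  rw [LinearMap.det_eq_det_mul_det W (LinearMap.id - S) he]
  have : W.mapQ W (LinearMap.id - S) he = LinearMap.id := by
    ext x
    simpa using hW x
  rw [this, LinearMap.det_id, mul_one]

/-- If `T = ∑ i, φ i (·) • e i`, then `det (I - T)` is the determinant of the matrix
`1 - (φ i (e j))`, whether or not the `e i` or the `φ i` are linearly independent. -/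
lemma detOneSub_eq_det {H ι : Type*} [NormedAddCommGroup H] [NormedSpace ℂ H] [Fintype ι]
    [DecidableEq ι] (T : H →L[ℂ] H) (φ : ι → H →L[ℂ] ℂ) (e : ι → H)
    (hT : ∀ x, T x = ∑ i, φ i x • e i) :
    HasFiniteRank T ∧ detOneSub T = Matrix.det (1 - Matrix.of fun i j => φ i (e j)) := by
  let f : H →ₗ[ℂ] (ι → ℂ) := LinearMap.pi fun i => (φ i : H →ₗ[ℂ] ℂ)
  let g : (ι → ℂ) →ₗ[ℂ] H := Fintype.linearCombination ℂ e
  have hgf : ∀ x, g (f x) = T x := fun x => by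
    simp [f, g, Fintype.linearCombination_apply, hT]
  have hfin : FiniteDimensional ℂ T.range := by
    refine Submodule.finiteDimensional_of_le (S₂ := LinearMap.range g) ?_
    rintro _ ⟨x, rfl⟩
    exact ⟨f x, hgf x⟩
  refine ⟨hfin, ?_⟩
  -- Sylvester's identity is applied to the restrictions `range T → range f` of `f` and
  -- `range f → range T` of `g`.
  let V := LinearMap.range f
  let gV : V →ₗ[ℂ] T.range := (g.domRestrict V).codRestrict T.range (by
    rintro ⟨_, x, rfl⟩
    exact ⟨x, (hgf x).symm⟩)
  let fR : T.range →ₗ[ℂ] V := f.rangeRestrict.domRestrict T.range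
  have h1 : detOneSub T = LinearMap.det (LinearMap.id - gV ∘ₗ fR) := by
    unfold detOneSub
    congr 1
    ext x
    simp [gV, fR, hgf]
  have h2 := det_id_sub_restrict (f ∘ₗ g) V fun x => ⟨g x, rfl⟩
  have h3 : LinearMap.det (LinearMap.id - fR ∘ₗ gV) = LinearMap.det (LinearMap.id - f ∘ₗ g) := by
    rw [h2]
    congr 1
  rw [h1, det_id_sub_comp_comm, h3, ← LinearMap.det_toMatrix', map_sub, LinearMap.toMatrix'_id]
  congr 2
  ext i j
  simp [LinearMap.toMatrix'_apply, f, g, Fintype.linearCombination_apply, Pi.single_apply]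

/-! ### Zeros of exponential polynomials and positivity of the determinant -/

/-- Rolle's theorem, counting zeros. -/
lemma exists_finset_deriv_eq_zero {f : ℝ → ℝ} (hf : Continuous f) (s : Finset ℝ)
    (hs : ∀ x ∈ s, f x = 0) :
    ∃ t : Finset ℝ, s.card ≤ t.card + 1 ∧ ∀ x ∈ t, deriv f x = 0 := by
  classical
  have key : ∀ x y : ℝ, ∃ z, x ∈ s → y ∈ s → x < y → z ∈ Ioo x y ∧ deriv f z = 0 := by
    intro x y
    by_cases h : x ∈ s ∧ y ∈ s ∧ x < y
    · obtain ⟨z, hz, hz'⟩ := exists_deriv_eq_zero h.2.2 hf.continuousOn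
        ((hs x h.1).trans (hs y h.2.1).symm)
      exact ⟨z, fun _ _ _ => ⟨hz, hz'⟩⟩
    · exact ⟨0, fun h1 h2 h3 => absurd ⟨h1, h2, h3⟩ h⟩
  choose c hc using key
  refine ⟨((s ×ˢ s).image fun p => c p.1 p.2).filter fun z => deriv f z = 0, ?_, by simp⟩
  refine Finset.card_le_of_interleaved fun x hx y hy hxy _ => ⟨c x y, ?_, (hc x y hx hy hxy).1⟩
  rw [Finset.mem_filter]
  exact ⟨Finset.mem_image.2 ⟨(x, y), Finset.mem_product.2 ⟨hx, hy⟩, rfl⟩, (hc x y hx hy hxy).2⟩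

open Polynomial in
/-- A nonzero exponential polynomial `Q(z) - e^{az} P(z)` with `deg Q < n` and `deg P < m` has
fewer than `n + m` real zeros: differentiation lowers `n` and preserves the form. -/
lemma eq_zero_of_eval_eq_exp_mul_eval {a : ℝ} (ha : a ≠ 0) (n m : ℕ) (P Q : ℝ[X])
    (hQ : Q.degree < n) (hP : P.degree < m) (s : Finset ℝ) (hcard : n + m ≤ s.card)
    (hs : ∀ x ∈ s, Q.eval x = Real.exp (a * x) * P.eval x) : Q = 0 ∧ P = 0 := by
  induction n generalizing P Q s with
  | zero =>
    have hQ0 : Q = 0 := by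
      simpa using hQ
    refine ⟨hQ0, Polynomial.eq_zero_of_degree_lt_of_eval_finset_eq_zero s
      (hP.trans_le (by exact_mod_cast (by omega : m ≤ s.card))) fun x hx => ?_⟩
    have := hs x hx
    rw [hQ0, eval_zero, eq_comm, mul_eq_zero] at this
    exact this.resolve_left (Real.exp_ne_zero _)
  | succ n ih =>
    have hderiv : ∀ x, HasDerivAt (fun x => Q.eval x - Real.exp (a * x) * P.eval x)
        (Q.derivative.eval x - Real.exp (a * x) * (P.derivative + C a * P).eval x) x := by
      intro x
      have h1 : HasDerivAt (fun x => Real.exp (a * x)) (Real.exp (a * x) * (a * 1)) x :=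
        ((hasDerivAt_id x).const_mul a).exp
      convert! (Q.hasDerivAt x).sub (h1.mul (P.hasDerivAt x)) using 1
      simp only [eval_add, eval_mul, eval_C]
      ring
    have hcont : Continuous fun x => Q.eval x - Real.exp (a * x) * P.eval x :=
      continuous_iff_continuousAt.2 fun x => (hderiv x).continuousAt
    obtain ⟨t, ht, ht0⟩ := exists_finset_deriv_eq_zero hcont s
      fun x hx => sub_eq_zero.2 (hs x hx)
    have hQ' : Q.derivative.degree < n := by
      by_cases h : Q.derivative = 0
      · rw [h, degree_zero]
        exact WithBot.bot_lt_coe n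
      · have hQne : Q ≠ 0 := fun h0 => h (by rw [h0, derivative_zero])
        have h1 := degree_derivative_lt hQne
        rw [degree_eq_natDegree h, degree_eq_natDegree hQne] at h1
        rw [degree_eq_natDegree hQne] at hQ
        rw [degree_eq_natDegree h]
        norm_cast at *
        omega
    have hP' : (P.derivative + C a * P).degree < m :=
      (degree_add_le _ _).trans_lt
        (max_lt ((degree_derivative_le).trans_lt hP) ((degree_C_mul ha).trans_lt hP))
    obtain ⟨hQ0, hP0⟩ := ih (P.derivative + C a * P) Q.derivative hQ' hP' t (by omega)
      fun x hx => sub_eq_zero.1 (by rw [← (hderiv x).deriv]; exact ht0 x hx)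
    -- `P ↦ P' + aP` is injective because it preserves the degree.
    have hPz : P = 0 := by
      by_contra hne
      have h1 : (C a * P).degree = P.degree := degree_C_mul ha
      have h2 : P.derivative.degree < (C a * P).degree := h1 ▸ degree_derivative_lt hne
      have h3 := degree_add_eq_right_of_degree_lt h2
      rw [hP0, degree_zero, h1, eq_comm, degree_eq_bot] at h3
      exact hne h3
    refine ⟨?_, hPz⟩
    obtain ⟨x, hx⟩ : s.Nonempty := Finset.card_pos.1 (by omega)
    have hC := eq_C_of_derivative_eq_zero hQ0
    have hx0 := hs x hx
    rw [hPz, eval_zero, mul_zero, hC, eval_C] at hx0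
    rw [hC, hx0, C_0]

section PoleNumerator

variable {ι : Type*} [Fintype ι] [DecidableEq ι]

open Polynomial in
/-- The polynomial `∏ i, (1 - z / v i) * ∑ j, c j / (z - v j)`. -/
def poleNumerator (v c : ι → ℝ) : ℝ[X] :=
  ∑ j, C (-c j / v j) * ∏ i ∈ Finset.univ.erase j, (1 - C (v i)⁻¹ * X)

open Polynomial in
lemma degree_poleNumerator_lt (v c : ι → ℝ) : (poleNumerator v c).degree < Fintype.card ι := by
  rw [poleNumerator]
  refine (degree_sum_le _ _).trans_lt ((Finset.sup_lt_iff (WithBot.bot_lt_coe _)).2 fun j _ => ?_)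
  refine ((degree_mul_le _ _).trans (add_le_add_left degree_C_le _)).trans_lt ?_
  rw [degree_prod, zero_add]
  calc ∑ i ∈ Finset.univ.erase j, (1 - C (v i)⁻¹ * X : ℝ[X]).degree
      ≤ ∑ i ∈ Finset.univ.erase j, (1 : WithBot ℕ) := by
        refine Finset.sum_le_sum fun i _ => ?_
        refine (degree_sub_le _ _).trans (max_le ?_ (degree_C_mul_X_le _))
        rw [degree_one]
        exact zero_le_one
    _ < Fintype.card ι := by
        rw [Finset.sum_const, Finset.card_erase_of_mem (Finset.mem_univ j), Finset.card_univ,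
          nsmul_one]
        have : 0 < Fintype.card ι := Fintype.card_pos_iff.2 ⟨j⟩
        exact_mod_cast (by omega : Fintype.card ι - 1 < Fintype.card ι)

lemma eval_poleNumerator_of_ne {v : ι → ℝ} (hv0 : ∀ i, v i ≠ 0) (c : ι → ℝ) {z : ℝ}
    (hz : ∀ i, z ≠ v i) :
    (poleNumerator v c).eval z = (∏ i, (1 - z / v i)) * ∑ j, c j / (z - v j) := by
  simp only [poleNumerator, Polynomial.eval_finsetSum, Polynomial.eval_mul, Polynomial.eval_C,
    Polynomial.eval_prod, Polynomial.eval_sub, Polynomial.eval_one, Polynomial.eval_X,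
    Finset.mul_sum]
  refine Finset.sum_congr rfl fun j _ => ?_
  rw [← Finset.mul_prod_erase Finset.univ _ (Finset.mem_univ j)]
  have h0 := hv0 j
  have h1 : z - v j ≠ 0 := sub_ne_zero.2 (hz j)
  have h2 : 1 - z / v j = -(z - v j) / v j := by field_simp; ring
  simp only [inv_mul_eq_div, h2]
  field_simp

lemma poleWeight_ne_zero {v : ι → ℝ} (hv : Function.Injective v) (hv0 : ∀ i, v i ≠ 0) (j : ι) :
    poleWeight v j ≠ 0 := by
  refine mul_ne_zero (neg_ne_zero.2 (hv0 j)) (Finset.prod_ne_zero_iff.2 fun i hi => inv_ne_zero ?_)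
  rw [sub_ne_zero, ne_comm, Ne, div_eq_one_iff_eq (hv0 i)]
  exact fun h => Finset.ne_of_mem_erase hi (hv h).symm

/-- At a node only the term with the matching pole survives; `poleWeight` is the reciprocal of the
derivative of `∏ i, (1 - z / v i)` there. -/
lemma eval_poleNumerator_self {v : ι → ℝ} (c : ι → ℝ) (hv0 : ∀ i, v i ≠ 0) (j : ι) :
    (poleNumerator v c).eval (v j) = c j / poleWeight v j := by
  simp only [poleNumerator, Polynomial.eval_finsetSum, Polynomial.eval_mul, Polynomial.eval_C,
    Polynomial.eval_prod, Polynomial.eval_sub, Polynomial.eval_one, Polynomial.eval_X]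
  rw [Finset.sum_eq_single j]
  · simp only [inv_mul_eq_div, poleWeight, Finset.prod_inv_distrib]
    rw [div_mul_eq_div_div, div_inv_eq_mul, div_neg, neg_div]
  · intro i _ hij
    rw [Finset.prod_eq_zero (Finset.mem_erase.2 ⟨hij.symm, Finset.mem_univ j⟩), mul_zero]
    rw [inv_mul_cancel₀ (hv0 j), sub_self]
  · simp

end PoleNumerator

section Positivity

variable {ι κ : Type*} [Fintype ι] [DecidableEq ι] [Fintype κ] [DecidableEq κ]

/-- The coefficient of `a e^{a x v i - a y w k}` in the kernel, after taking residues at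
`ζ = v i` and `ω = w k`. -/
def residueMatrix (v : ι → ℝ) (w : κ → ℝ) : Matrix ι κ ℝ := Matrix.of fun i k =>
  poleWeight v i * poleWeight w k *
    ((∏ k', (1 - v i / w k')) * (∏ i', (1 - w k / v i')) / (v i - w k))

/-- The matrix of the integrals `∫ y in Ici 1, a * e^{- a y w k} * e^{a y v i}`. -/
def overlapMatrix (a : ℝ) (v : ι → ℝ) (w : κ → ℝ) : Matrix κ ι ℝ := Matrix.of fun k i =>
  Real.exp (-(a * (w k - v i))) / (w k - v i)

/-- A vector fixed by `residueMatrix v w * overlapMatrix a v w` yields polynomials `Q`, `P` with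
`deg Q < |ι|`, `deg P < |κ|` and `Q(z) = e^{az} P(z)` at all the `|ι| + |κ|` points `v i`, `w k`,
so that both vanish. -/
lemma det_one_sub_residueMatrix_mul_ne_zero {a : ℝ} (ha : a ≠ 0) {v : ι → ℝ} {w : κ → ℝ}
    (hv : Function.Injective v) (hw : Function.Injective w) (hv0 : ∀ i, v i < 0)
    (hw0 : ∀ k, 0 < w k) : (1 - residueMatrix v w * overlapMatrix a v w).det ≠ 0 := by
  intro hdet
  obtain ⟨x, hx0, hx⟩ := Matrix.exists_mulVec_eq_zero_iff.2 hdet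
  rw [Matrix.sub_mulVec, Matrix.one_mulVec, sub_eq_zero, ← Matrix.mulVec_mulVec] at hx
  have hvne : ∀ i, v i ≠ 0 := fun i => (hv0 i).ne
  have hwne : ∀ k, w k ≠ 0 := fun k => (hw0 k).ne'
  have hvw : ∀ i k, v i ≠ w k := fun i k => ((hv0 i).trans (hw0 k)).ne
  set g := (overlapMatrix a v w).mulVec x with hg
  let d : κ → ℝ := fun k => poleWeight w k * (∏ i, (1 - w k / v i)) * g k
  let P := poleNumerator w d
  let Q := poleNumerator v fun i => Real.exp (a * v i) * x i
  have hPv : ∀ i, x i = poleWeight v i * P.eval (v i) := by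
    intro i
    rw [eval_poleNumerator_of_ne hwne d fun k => hvw i k]
    conv_lhs => rw [hx]
    simp only [Matrix.mulVec, dotProduct, residueMatrix, Matrix.of_apply, d, Finset.mul_sum]
    exact Finset.sum_congr rfl fun k _ => by ring
  have hQv : ∀ i, Q.eval (v i) = Real.exp (a * v i) * P.eval (v i) := by
    intro i
    rw [eval_poleNumerator_self _ hvne, mul_div_assoc]
    congr 1
    rw [div_eq_iff (poleWeight_ne_zero hv hvne i), hPv i, mul_comm]
  have hQw : ∀ k, Q.eval (w k) = Real.exp (a * w k) * P.eval (w k) := by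
    intro k
    have h1 := poleWeight_ne_zero hw hwne k
    have h2 : d k / poleWeight w k = (∏ i, (1 - w k / v i)) * g k := by
      simp only [d]
      field_simp
    rw [eval_poleNumerator_self _ hwne, eval_poleNumerator_of_ne hvne _ fun i => (hvw i k).symm, h2,
      mul_left_comm]
    congr 1
    simp only [hg, Matrix.mulVec, dotProduct, overlapMatrix, Matrix.of_apply, Finset.mul_sum]
    refine Finset.sum_congr rfl fun i _ => ?_
    have : Real.exp (a * v i) = Real.exp (a * w k) * Real.exp (-(a * (w k - v i))) := by
      rw [← Real.exp_add]
      ring_nf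
    rw [this]
    ring
  have hinj : Function.Injective (Sum.elim v w) := hv.sumElim hw hvw
  obtain ⟨-, hP0⟩ := eq_zero_of_eval_eq_exp_mul_eval ha (Fintype.card ι) (Fintype.card κ) P Q
    (degree_poleNumerator_lt _ _) (degree_poleNumerator_lt _ _)
    (Finset.univ.image (Sum.elim v w))
    (by rw [Finset.card_image_of_injective _ hinj, Finset.card_univ, Fintype.card_sum])
    (by
      intro z hz
      obtain ⟨i | k, -, rfl⟩ := Finset.mem_image.1 hz
      exacts [hQv i, hQw k])
  exact hx0 (funext fun i => by rw [hPv i, hP0]; simp)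

/-- The determinant is continuous in `a`, tends to `1` as `a → ∞` and never vanishes. -/
lemma det_one_sub_residueMatrix_mul_pos {a : ℝ} (ha : 0 < a) {v : ι → ℝ} {w : κ → ℝ}
    (hv : Function.Injective v) (hw : Function.Injective w) (hv0 : ∀ i, v i < 0)
    (hw0 : ∀ k, 0 < w k) : 0 < (1 - residueMatrix v w * overlapMatrix a v w).det := by
  let D : ℝ → ℝ := fun b => (1 - residueMatrix v w * overlapMatrix b v w).det
  have hcont : Continuous D := by
    refine Continuous.matrix_det (continuous_const.sub (continuous_const.matrix_mul ?_))
    refine continuous_pi fun k => continuous_pi fun i => ?_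
    simp only [overlapMatrix, Matrix.of_apply]
    fun_prop
  have hlim : Filter.Tendsto D Filter.atTop (nhds 1) := by
    have h0 : Filter.Tendsto (fun b => overlapMatrix b v w) Filter.atTop (nhds 0) := by
      refine tendsto_pi_nhds.2 fun k => tendsto_pi_nhds.2 fun i => ?_
      have hpos : 0 < w k - v i := by linarith [hv0 i, hw0 k]
      have := (Real.tendsto_exp_neg_atTop_nhds_zero.comp
        (Filter.tendsto_id.atTop_mul_const hpos)).div_const (w k - v i)
      simpa [overlapMatrix, Function.comp_def] using this
    have hF : Continuous fun G : Matrix κ ι ℝ => (1 - residueMatrix v w * G).det :=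
      Continuous.matrix_det (continuous_const.sub (continuous_const.matrix_mul continuous_id))
    have := (hF.tendsto 0).comp h0
    simpa [Function.comp_def, D] using this
  by_contra hle
  obtain ⟨b, hb, hab⟩ := ((hlim.eventually (lt_mem_nhds zero_lt_one)).and
    (Filter.eventually_ge_atTop a)).exists
  obtain ⟨c, hc, hc0⟩ := intermediate_value_Icc hab hcont.continuousOn
    ⟨not_lt.1 hle, hb.le⟩
  exact det_one_sub_residueMatrix_mul_ne_zero (ha.trans_le hc.1).ne' hv hw hv0 hw0 hc0

end Positivity

/-! ### Integral operators with exponential kernels -/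

lemma integrableOn_Ici_exp_neg_mul {s : ℝ} (hs : 0 < s) :
    IntegrableOn (fun x => Real.exp (-(s * x))) (Ici 1) := by
  rw [integrableOn_Ici_iff_integrableOn_Ioi]
  simpa only [neg_mul] using integrableOn_exp_mul_Ioi (neg_neg_iff_pos.2 hs) 1

lemma integral_Ici_exp_neg_mul {s : ℝ} (hs : 0 < s) :
    ∫ x in Ici (1 : ℝ), Real.exp (-(s * x)) = Real.exp (-s) / s := by
  rw [integral_Ici_eq_integral_Ioi]
  simpa using integral_exp_mul_Ioi (neg_neg_iff_pos.2 hs) 1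

lemma memLp_exp_neg_mul {s : ℝ} (hs : 0 < s) :
    MemLp (fun x : ℝ => (Real.exp (-(s * x)) : ℂ)) 2 (volume.restrict (Ici (1 : ℝ))) := by
  rw [memLp_two_iff_integrable_sq_norm (by fun_prop)]
  refine (integrableOn_Ici_exp_neg_mul (s := 2 * s) (by positivity)).congr
    (Filter.Eventually.of_forall fun x => ?_)
  simp only [Complex.norm_real, Real.norm_eq_abs, Real.abs_exp, ← Real.exp_nat_mul]
  congr 1
  push_cast
  ring

/-- The function `x ↦ e^{-s x}` as an element of `L²[1, ∞)`. -/
def expL2 {s : ℝ} (hs : 0 < s) : L2Ici := (memLp_exp_neg_mul hs).toLp _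

lemma coeFn_expL2 {s : ℝ} (hs : 0 < s) :
    expL2 hs =ᵐ[volume.restrict (Ici (1 : ℝ))] fun x => (Real.exp (-(s * x)) : ℂ) :=
  MemLp.coeFn_toLp _

lemma inner_expL2_ae {s : ℝ} (hs : 0 < s) (f : L2Ici) :
    (fun y => inner ℂ (expL2 hs y) (f y)) =ᵐ[volume.restrict (Ici (1 : ℝ))]
      fun y => (Real.exp (-(s * y)) : ℂ) * f y := by
  filter_upwards [coeFn_expL2 hs] with y hy
  rw [hy, RCLike.inner_apply, Complex.conj_ofReal, mul_comm]

lemma integrable_exp_mul {s : ℝ} (hs : 0 < s) (f : L2Ici) :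
    IntegrableOn (fun y => (Real.exp (-(s * y)) : ℂ) * f y) (Ici 1) :=
  (L2.integrable_inner (expL2 hs) f).congr (inner_expL2_ae hs f)

lemma inner_expL2_left {s : ℝ} (hs : 0 < s) (f : L2Ici) :
    inner ℂ (expL2 hs) f = ∫ y in Ici (1 : ℝ), (Real.exp (-(s * y)) : ℂ) * f y := by
  rw [L2.inner_def]
  exact integral_congr_ae (inner_expL2_ae hs f)

lemma inner_expL2_expL2 {s t : ℝ} (hs : 0 < s) (ht : 0 < t) :
    inner ℂ (expL2 hs) (expL2 ht) = ((Real.exp (-(s + t)) / (s + t) : ℝ) : ℂ) := by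
  rw [inner_expL2_left, ← integral_Ici_exp_neg_mul (add_pos hs ht), ← integral_complex_ofReal]
  refine integral_congr_ae ?_
  filter_upwards [coeFn_expL2 ht] with y hy
  rw [hy, ← Complex.ofReal_mul, ← Real.exp_add]
  ring_nf

/-- The integral operator whose kernel is a real bilinear combination of decaying exponentials, and
its determinant. -/
lemma exists_isIntegralOperator_of_exp_kernel {ι κ : Type*} [Fintype ι] [DecidableEq ι] [Fintype κ]
    {s : ι → ℝ} {t : κ → ℝ} (hs : ∀ i, 0 < s i) (ht : ∀ k, 0 < t k) (c : ι → κ → ℝ)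
    {K : ℝ → ℝ → ℂ}
    (hK : ∀ x y, K x y =
      ∑ i, ∑ k, (c i k * Real.exp (-(s i * x)) * Real.exp (-(t k * y)) : ℂ)) :
    ∃ T : L2Ici →L[ℂ] L2Ici, IsIntegralOperator K T ∧ HasFiniteRank T ∧
      detOneSub T = ((Matrix.det (1 - Matrix.of fun i j =>
        ∑ k, c i k * (Real.exp (-(t k + s j)) / (t k + s j))) : ℝ) : ℂ) := by
  let φ : ι → L2Ici →L[ℂ] ℂ := fun i => ∑ k, (c i k : ℂ) • innerSL ℂ (expL2 (ht k))
  have hφ : ∀ i f, φ i f = ∑ k, (c i k : ℂ) * inner ℂ (expL2 (ht k)) f := fun i f => by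
    simp [φ]
  let T : L2Ici →L[ℂ] L2Ici := ∑ i, (φ i).smulRight (expL2 (hs i))
  have hT : ∀ f, T f = ∑ i, φ i f • expL2 (hs i) := fun f => by simp [T]
  obtain ⟨hfin, hdet⟩ := detOneSub_eq_det T φ (fun i => expL2 (hs i)) hT
  refine ⟨T, fun f => ?_, hfin, ?_⟩
  · have hfun : ∀ x, (fun y => K x y * f y) = fun y => ∑ i, ∑ k,
        (c i k * Real.exp (-(s i * x)) : ℂ) * ((Real.exp (-(t k * y)) : ℂ) * f y) := by
      intro x
      funext y
      simp only [hK, Finset.sum_mul]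
      exact Finset.sum_congr rfl fun i _ => Finset.sum_congr rfl fun k _ => by ring
    have hint : ∀ x i k, IntegrableOn (fun y => (c i k * Real.exp (-(s i * x)) : ℂ) *
        ((Real.exp (-(t k * y)) : ℂ) * f y)) (Ici 1) := fun x i k =>
      (integrable_exp_mul (ht k) f).const_mul _
    refine ⟨Filter.Eventually.of_forall fun x => ?_, ?_⟩
    · rw [hfun]
      exact integrable_finsetSum _ fun i _ => integrable_finsetSum _ fun k _ => hint x i k
    · have hcoe : T f =ᵐ[volume.restrict (Ici (1 : ℝ))]
          fun x => ∑ i, φ i f * (Real.exp (-(s i * x)) : ℂ) := by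
        rw [hT]
        have hsum := Lp.coeFn_finsetSum Finset.univ fun i => φ i f • expL2 (hs i)
        have hall : ∀ᵐ x ∂(volume.restrict (Ici (1 : ℝ))), ∀ i,
            (φ i f • expL2 (hs i) : L2Ici) x = φ i f * (Real.exp (-(s i * x)) : ℂ) := by
          refine ae_all_iff.2 fun i => ?_
          filter_upwards [Lp.coeFn_smul (φ i f) (expL2 (hs i)), coeFn_expL2 (hs i)] with x h1 h2
          rw [h1, Pi.smul_apply, h2, smul_eq_mul]
        filter_upwards [hsum, hall] with x h1 h2
        rw [h1]
        simp [h2]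
      filter_upwards [hcoe] with x hx
      rw [hx, hfun, integral_finsetSum _ fun i _ => integrable_finsetSum _ fun k _ => hint x i k]
      refine Finset.sum_congr rfl fun i _ => ?_
      rw [integral_finsetSum _ fun k _ => hint x i k, hφ, Finset.sum_mul]
      refine Finset.sum_congr rfl fun k _ => ?_
      rw [integral_const_mul, inner_expL2_left]
      ring
  · rw [hdet, ← Complex.ofRealHom_eq_coe, RingHom.map_det]
    congr 1
    ext i j
    simp only [hφ, inner_expL2_expL2]
    simp [Matrix.one_apply, apply_ite]

section Kernels

variable {n m : ℕ} {a : ℝ} {ν : Fin (n + m) → ℝ} {γ₁ γ₂ : SimpleClosedContour}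

/-- Both iterated integrals of the integrand of `kernelM` equal the sum of its residues; in
particular the order of integration is immaterial, which relates `kernelMHat` to `kernelM`. -/
lemma integral_integral_kernelM_integrand (hν : StrictMono ν)
    (hneg : ∀ j : Fin n, ν (Fin.castAdd m j) < 0) (hpos : ∀ j : Fin m, 0 < ν (Fin.natAdd n j))
    (hγ₁ : γ₁.PositivelyOriented) (hγ₂ : γ₂.PositivelyOriented)
    (hleft : ∀ z ∈ γ₁.trace, z.re < 0) (hright : ∀ z ∈ γ₂.trace, 0 < z.re)
    (hin₁ : ∀ j : Fin n, (ν (Fin.castAdd m j) : ℂ) ∈ γ₁.interior)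
    (hin₂ : ∀ j : Fin m, (ν (Fin.natAdd n j) : ℂ) ∈ γ₂.interior) (x y : ℝ)
    {J : ℂ → ℂ → ℂ} (hJ : ∀ ζ ω, J ζ ω = Complex.exp (a * x * ζ - a * y * ω) * (1 / (ζ - ω)) *
      (∏ j : Fin n, (1 - ω / (ν (Fin.castAdd m j) : ℂ)) / (1 - ζ / (ν (Fin.castAdd m j) : ℂ))) *
      (∏ j : Fin m, (1 - ζ / (ν (Fin.natAdd n j) : ℂ)) / (1 - ω / (ν (Fin.natAdd n j) : ℂ))))
    {S : ℂ} (hS : S = ∑ i, ∑ k, (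
      (residueMatrix (fun i => ν (Fin.castAdd m i)) (fun k => ν (Fin.natAdd n k)) i k : ℂ)
        * Real.exp (-(-(a * ν (Fin.castAdd m i)) * x)) *
        Real.exp (-(a * ν (Fin.natAdd n k) * y)) : ℂ)) :
    (γ₁.integral fun ζ => γ₂.integral fun ω => J ζ ω) = (2 * Real.pi * Complex.I) ^ 2 * S ∧
    (γ₂.integral fun ω => γ₁.integral fun ζ => J ζ ω) = (2 * Real.pi * Complex.I) ^ 2 * S := by
  have hne : ∀ ζ ω : ℂ, ζ.re < 0 → 0 < ω.re → ζ - ω ≠ 0 := fun ζ ω h1 h2 h => by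
    rw [sub_eq_zero.1 h] at h1
    exact lt_asymm h1 h2
  have hv : Function.Injective fun i => (ν (Fin.castAdd m i) : ℂ) :=
    Complex.ofReal_injective.comp (hν.injective.comp (Fin.castAdd_injective n m))
  have hw : Function.Injective fun k => (ν (Fin.natAdd n k) : ℂ) :=
    Complex.ofReal_injective.comp (hν.injective.comp (Fin.natAdd_injective m n))
  have hv0 : ∀ i, (ν (Fin.castAdd m i) : ℂ) ≠ 0 := fun i => by exact_mod_cast (hneg i).ne
  have hw0 : ∀ k, (ν (Fin.natAdd n k) : ℂ) ≠ 0 := fun k => by exact_mod_cast (hpos k).ne'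
  have hvU : ∀ i, (ν (Fin.castAdd m i) : ℂ) ∈ {z : ℂ | z.re < 0} := fun i => by
    simpa using hneg i
  have hwU : ∀ k, (ν (Fin.natAdd n k) : ℂ) ∈ {z : ℂ | 0 < z.re} := fun k => by
    simpa using hpos k
  have hU₁ : IsOpen {z : ℂ | z.re < 0} := isOpen_lt Complex.continuous_re continuous_const
  have hU₂ : IsOpen {z : ℂ | 0 < z.re} := isOpen_lt continuous_const Complex.continuous_re
  let g : ℂ → ℂ → ℂ := fun ζ ω => Complex.exp (a * x * ζ - a * y * ω) *
      ((∏ j : Fin m, (1 - ζ / (ν (Fin.natAdd n j) : ℂ))) *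
        (∏ j : Fin n, (1 - ω / (ν (Fin.castAdd m j) : ℂ))) / (ζ - ω))
  have hg₁ : ∀ ω ∈ {z : ℂ | 0 < z.re}, DifferentiableOn ℂ (fun ζ => g ζ ω) {z | z.re < 0} :=
    fun ω hω => DifferentiableOn.mul (by fun_prop) (DifferentiableOn.div (by fun_prop)
      (by fun_prop) fun ζ hζ => hne ζ ω hζ hω)
  have hg₂ : ∀ ζ ∈ {z : ℂ | z.re < 0}, DifferentiableOn ℂ (g ζ) {z | 0 < z.re} :=
    fun ζ hζ => DifferentiableOn.mul (by fun_prop) (DifferentiableOn.div (by fun_prop)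
      (by fun_prop) fun ω hω => hne ζ ω hζ hω)
  have hsum : ∑ i, ∑ k, poleWeight (fun i => (ν (Fin.castAdd m i) : ℂ)) i *
      poleWeight (fun k => (ν (Fin.natAdd n k) : ℂ)) k *
        g (ν (Fin.castAdd m i)) (ν (Fin.natAdd n k)) = S := by
    rw [hS]
    refine Finset.sum_congr rfl fun i _ => Finset.sum_congr rfl fun k _ => ?_
    have hexp : Complex.exp (a * x * (ν (Fin.castAdd m i) : ℂ) -
        a * y * (ν (Fin.natAdd n k) : ℂ)) =
        (Real.exp (-(-(a * ν (Fin.castAdd m i)) * x)) : ℂ) *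
          (Real.exp (-(a * ν (Fin.natAdd n k) * y)) : ℂ) := by
      push_cast
      rw [← Complex.exp_add]
      ring_nf
    simp only [g, hexp, residueMatrix, Matrix.of_apply, Complex.ofReal_mul, ofReal_poleWeight]
    push_cast
    ring
  constructor
  · rw [← hsum, ← SimpleClosedContour.integral_integral_div_prod hγ₁ hγ₂
      (convex_halfSpace_re_lt 0) hU₁ (convex_halfSpace_re_gt 0) hU₂ hleft hright hv hv0 hin₁ hvU
      hw hw0 hin₂ hwU hg₁ hg₂]
    congr! 4 with ζ ω
    simp only [hJ, g, Finset.prod_div_distrib]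
    ring
  · rw [← hsum, Finset.sum_comm]
    simp only [mul_comm (poleWeight (fun i => (ν (Fin.castAdd m i) : ℂ)) _)]
    rw [← SimpleClosedContour.integral_integral_div_prod (g := fun ω ζ => g ζ ω) hγ₂ hγ₁
      (convex_halfSpace_re_gt 0) hU₂ (convex_halfSpace_re_lt 0) hU₁ hright hleft hw hw0 hin₂ hwU
      hv hv0 hin₁ hvU hg₂ hg₁]
    congr! 4 with ω ζ
    simp only [hJ, g, Finset.prod_div_distrib]
    ring

end Kernels

end

theorem lemma1p1 (n m : ℕ) (a : ℝ) (ha : 0 < a) (ν : Fin (n + m) → ℝ) (hν : StrictMono ν)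
    (hneg : ∀ j : Fin n, ν (Fin.castAdd m j) < 0) (hpos : ∀ j : Fin m, 0 < ν (Fin.natAdd n j))
    (γ₁ γ₂ : SimpleClosedContour)
    (hγ₁ : γ₁.PositivelyOriented) (hγ₂ : γ₂.PositivelyOriented)
    (hleft : ∀ z ∈ γ₁.trace, z.re < 0) (hright : ∀ z ∈ γ₂.trace, 0 < z.re)
    (hin₁ : ∀ j : Fin n, (ν (Fin.castAdd m j) : ℂ) ∈ γ₁.interior)
    (hin₂ : ∀ j : Fin m, (ν (Fin.natAdd n j) : ℂ) ∈ γ₂.interior) :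
    (∃ T : L2Ici →L[ℂ] L2Ici, IsIntegralOperator (kernelM a ν γ₁ γ₂) T ∧ HasFiniteRank T ∧
      (detOneSub T).im = 0 ∧ 0 < (detOneSub T).re) ∧
    (∃ T : L2Ici →L[ℂ] L2Ici, IsIntegralOperator (kernelMHat a ν γ₁ γ₂) T ∧ HasFiniteRank T ∧
      (detOneSub T).im = 0 ∧ 0 < (detOneSub T).re) := by
  set v : Fin n → ℝ := fun i => ν (Fin.castAdd m i) with hv
  set w : Fin m → ℝ := fun k => ν (Fin.natAdd n k) with hw
  have hdet := det_one_sub_residueMatrix_mul_pos ha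
    (hν.injective.comp (Fin.castAdd_injective n m) : Function.Injective v)
    (hν.injective.comp (Fin.natAdd_injective m n) : Function.Injective w) hneg hpos
  have hI : (2 * Real.pi * Complex.I : ℂ) ^ 2 ≠ 0 := pow_ne_zero 2 Complex.two_pi_I_ne_zero
  have hs : ∀ i, 0 < -(a * v i) := fun i => neg_pos.2 (mul_neg_of_pos_of_neg ha (hneg i))
  have ht : ∀ k, 0 < a * w k := fun k => mul_pos ha (hpos k)
  have hover : ∀ i k, a * (Real.exp (-(a * w k + -(a * v i))) / (a * w k + -(a * v i))) =
      overlapMatrix a v w k i := by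
    intro i k
    have h1 : a * w k + -(a * v i) = a * (w k - v i) := by ring
    rw [h1, overlapMatrix, Matrix.of_apply, mul_div_assoc', mul_div_mul_left _ _ ha.ne']
  constructor
  · obtain ⟨T, hT, hfin, hdetT⟩ := exists_isIntegralOperator_of_exp_kernel hs ht
      (fun i k => a * residueMatrix v w i k) (K := kernelM a ν γ₁ γ₂) (fun x y => by
        rw [kernelM, (integral_integral_kernelM_integrand hν hneg hpos hγ₁ hγ₂ hleft hright hin₁
          hin₂ x y (fun _ _ => rfl) rfl).1, ← mul_assoc, div_mul_cancel₀ _ hI]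
        simp only [Finset.mul_sum]
        congr! 2 with i _ k _
        push_cast
        ring)
    have hmat : (1 - residueMatrix v w * overlapMatrix a v w).det = Matrix.det (1 - Matrix.of
        fun i j => ∑ k, a * residueMatrix v w i k *
          (Real.exp (-(a * w k + -(a * v j))) / (a * w k + -(a * v j)))) := by
      congr 2
      ext i j
      simp only [Matrix.mul_apply, Matrix.of_apply, ← hover]
      exact Finset.sum_congr rfl fun k _ => by ring
    refine ⟨T, hT, hfin, ?_, ?_⟩
    · rw [hdetT, Complex.ofReal_im]
    · rwa [hdetT, Complex.ofReal_re, ← hmat]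
  · obtain ⟨T, hT, hfin, hdetT⟩ := exists_isIntegralOperator_of_exp_kernel ht hs
      (fun k i => a * residueMatrix v w i k) (K := kernelMHat a ν γ₁ γ₂) (fun x y => by
        rw [kernelMHat, (integral_integral_kernelM_integrand hν hneg hpos hγ₁ hγ₂ hleft hright
          hin₁ hin₂ y x (fun ζ ω => by rw [mul_right_comm, neg_add_eq_sub]) rfl).2, ← mul_assoc,
          div_mul_cancel₀ _ hI, Finset.sum_comm]
        simp only [Finset.mul_sum]
        congr! 2 with k _ i _
        push_cast
        ring)
    -- The matrix is the transpose of the product in the opposite order.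
    have hmat : (1 - residueMatrix v w * overlapMatrix a v w).det = Matrix.det (1 - Matrix.of
        fun k l => ∑ i, a * residueMatrix v w i k *
          (Real.exp (-(-(a * v i) + a * w l)) / (-(a * v i) + a * w l))) := by
      rw [Matrix.det_one_sub_mul_comm, ← Matrix.det_transpose, Matrix.transpose_sub,
        Matrix.transpose_one]
      congr 2
      ext k l
      simp only [Matrix.transpose_apply, Matrix.mul_apply, Matrix.of_apply, ← hover]
      exact Finset.sum_congr rfl fun i _ => by rw [add_comm (-(a * v i))]; ring
    refine ⟨T, hT, hfin, ?_, ?_⟩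
    · rw [hdetT, Complex.ofReal_im]
    · rwa [hdetT, Complex.ofReal_re, ← hmat]
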